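/- All graphs are simple, every edge has length $1$, and a graph $G$ is regarded as the metric space formed by its vertices and all points of its edges, with the shortest-path distance $d_G$ (equal to $\infty$ between points of different connected components). A geodesic is a curve $\gamma:[a,b]\to G$ with $d_G(\gamma(s),\gamma(t))=|s-t|$ for all $s,t\in[a,b]$. $G$ is called hyperbolic if there is $\delta\ge 0$ such that for every geodesic triangle in $G$ each side is contained in the $\delta$-neighborhood of the union of the other two sides (if $G$ is not connected, this means that all its connected components satisfy the condition with one common $\delta$). $G$ is called bounded if its diameter $\sup\{d_G(x,y): x,y\in G\}$ is finite. The direct product $G_1\times G_2$ has vertex set $V(G_1)\times V(G_2)$, and $(u_1,v_1)$, $(u_2,v_2)$ are adjacent if and only if $u_1u_2\in E(G_1)$ and $v_1v_2\in E(G_2)$. Theorem. Let $G_1,G_2$ be connected simple graphs (finite or infinite), each with at least two vertices. If $G_1\times G_2$ is hyperbolic, then one of the two factors is hyperbolic and the other one is bounded; that is, either $G_1$ is hyperbolic and $G_2$ is bounded, or $G_2$ is hyperbolic and $G_1$ is bounded. -/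

import Mathlib

open scoped ENNReal NNReal

namespace GraphHyp

universe u v

/-- The direct product `G × H`: `(a, b)` and `(a', b')` are adjacent when `a ~ a'` in `G` and
`b ~ b'` in `H`. -/
def directProduct {V : Type u} {W : Type v} (G : SimpleGraph V) (H : SimpleGraph W) :
    SimpleGraph (V × W) where
  Adj p q := G.Adj p.1 q.1 ∧ H.Adj p.2 q.2
  symm := ⟨fun _ _ h => ⟨h.1.symm, h.2.symm⟩⟩
  loopless := ⟨fun _ h => G.loopless.irrefl _ h.1⟩

/-- The points of the graph `G` regarded as a geometric object, in barycentric coordinates: the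
vertex `a` is `single a 1`, and the point of the edge `[a, b]` at distance `t ∈ [0, 1]` from `a` is
`single a (1 - t) + single b t`. -/
@[ext] structure Realization {V : Type u} (G : SimpleGraph V) : Type u where
  val : V →₀ ℝ
  property : ∃ (a b : V) (t : ℝ), (a = b ∨ G.Adj a b) ∧ 0 ≤ t ∧ t ≤ 1 ∧
    val = Finsupp.single a (1 - t) + Finsupp.single b t

namespace Realization

variable {V : Type u} {G : SimpleGraph V}

/-- The barycentric coordinate of the point `x` at the vertex `a`. If it is nonzero, then `a` is an
end of the edge that carries `x` (or `x` is the vertex `a`), at distance `1 - x.coord a` from `x`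
along that edge. -/
def coord (x : Realization G) (a : V) : ℝ := x.1 a

/-- The vertex `a`, as a point of the realization. -/
noncomputable def vertex (G : SimpleGraph V) (a : V) : Realization G :=
  ⟨Finsupp.single a 1, a, a, 0, Or.inl rfl, le_rfl, zero_le_one, by simp⟩

/-- The closed edge `[a, b]` contains the point `x`. -/
def OnEdge (x : Realization G) (a b : V) : Prop :=
  G.Adj a b ∧ ∀ c, x.coord c ≠ 0 → c = a ∨ c = b

/-- The least length of a path from `x` to `y` through at least one vertex: it leaves the edge of
`x` at an end `a`, runs from `a` to `b` in `G`, and enters the edge of `y` at its end `b`. -/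
noncomputable def distVia (x y : Realization G) : ℝ≥0∞ :=
  ⨅ (a : V) (b : V) (_ : x.coord a ≠ 0) (_ : y.coord b ≠ 0),
    ENNReal.ofReal (1 - x.coord a) + (G.edist a b : ℝ≥0∞) + ENNReal.ofReal (1 - y.coord b)

/-- The distance of `x` and `y` along an edge that contains both, and `∞` if there is none. -/
noncomputable def distAlong (x y : Realization G) : ℝ≥0∞ :=
  ⨅ (a : V) (b : V) (_ : x.OnEdge a b) (_ : y.OnEdge a b),
    ENNReal.ofReal |x.coord a - y.coord a|

/-- The shortest-path distance of the graph in which every edge has length `1`; it is `∞` for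
points of different connected components. -/
noncomputable instance : EDist (Realization G) := ⟨fun x y => min (distVia x y) (distAlong x y)⟩

theorem edist_def (x y : Realization G) : edist x y = min (distVia x y) (distAlong x y) := rfl

theorem coord_nonneg (x : Realization G) (c : V) : 0 ≤ x.coord c := by
  classical
  obtain ⟨x, a, b, t, -, h0, h1, rfl⟩ := x
  simp only [coord, Finsupp.add_apply, Finsupp.single_apply]
  split_ifs <;> linarith

theorem coord_le_one (x : Realization G) (c : V) : x.coord c ≤ 1 := by
  classical
  obtain ⟨x, a, b, t, -, h0, h1, rfl⟩ := x
  simp only [coord, Finsupp.add_apply, Finsupp.single_apply]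
  split_ifs <;> linarith

theorem coord_add_le_one (x : Realization G) {c d : V} (h : c ≠ d) :
    x.coord c + x.coord d ≤ 1 := by
  classical
  obtain ⟨x, a, b, t, -, h0, h1, rfl⟩ := x
  simp only [coord, Finsupp.add_apply, Finsupp.single_apply]
  split_ifs <;> first | linarith | (exfalso; grind)

theorem coord_pair (x : Realization G) {c d : V} (h : c ≠ d) (hc : x.coord c ≠ 0)
    (hd : x.coord d ≠ 0) : G.Adj c d ∧ x.coord c + x.coord d = 1 ∧ x.OnEdge c d := by
  classical
  obtain ⟨x, a, b, t, hab, h0, h1, rfl⟩ := x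
  simp only [OnEdge, coord, Finsupp.add_apply, Finsupp.single_apply] at hc hd ⊢
  have := G.adj_comm a b
  grind

theorem OnEdge.add_eq {x : Realization G} {c d : V} (h : x.OnEdge c d) :
    x.coord c + x.coord d = 1 := by
  classical
  have hcd := h.1.ne
  have h2 := h.2
  obtain ⟨x, a, b, t, hab, h0, h1, rfl⟩ := x
  have ha := h2 a
  have hb := h2 b
  simp only [coord, Finsupp.add_apply, Finsupp.single_apply] at ha hb ⊢
  grind

theorem OnEdge.symm {x : Realization G} {c d : V} (h : x.OnEdge c d) : x.OnEdge d c :=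
  ⟨h.1.symm, fun e he => (h.2 e he).symm⟩

theorem exists_coord_ne (x : Realization G) : ∃ c, x.coord c ≠ 0 := by
  classical
  obtain ⟨x, a, b, t, hab, h0, h1, rfl⟩ := x
  by_contra! h
  have ha := h a
  have hb := h b
  simp only [coord, Finsupp.add_apply, Finsupp.single_apply] at ha hb
  grind

theorem edist_le_via (x y : Realization G) {a b : V} (ha : x.coord a ≠ 0) (hb : y.coord b ≠ 0) :
    edist x y ≤ ENNReal.ofReal (1 - x.coord a) + (G.edist a b : ℝ≥0∞)
      + ENNReal.ofReal (1 - y.coord b) :=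
  (min_le_left _ _).trans <| iInf_le_of_le a <| iInf_le_of_le b <| iInf_le_of_le ha <|
    iInf_le_of_le hb le_rfl

theorem edist_le_along (x y : Realization G) {a b : V} (ha : x.OnEdge a b) (hb : y.OnEdge a b) :
    edist x y ≤ ENNReal.ofReal |x.coord a - y.coord a| :=
  (min_le_right _ _).trans <| iInf_le_of_le a <| iInf_le_of_le b <| iInf_le_of_le ha <|
    iInf_le_of_le hb le_rfl

theorem le_edist {x y : Realization G} {r : ℝ≥0∞}
    (h1 : ∀ a b, x.coord a ≠ 0 → y.coord b ≠ 0 →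
      r ≤ ENNReal.ofReal (1 - x.coord a) + (G.edist a b : ℝ≥0∞) + ENNReal.ofReal (1 - y.coord b))
    (h2 : ∀ a b, x.OnEdge a b → y.OnEdge a b → r ≤ ENNReal.ofReal |x.coord a - y.coord a|) :
    r ≤ edist x y := by
  refine le_min ?_ ?_
  · simp only [distVia, le_iInf_iff]; exact h1
  · simp only [distAlong, le_iInf_iff]; exact h2

protected theorem edist_comm (x y : Realization G) : edist x y = edist y x := by
  have key : ∀ x y : Realization G, edist x y ≤ edist y x := by
    intro x y
    refine le_edist (fun a b ha hb => ?_) (fun a b ha hb => ?_)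
    · refine (edist_le_via x y hb ha).trans (le_of_eq ?_)
      rw [SimpleGraph.edist_comm]; ring
    · rw [abs_sub_comm]; exact edist_le_along x y hb ha
  exact le_antisymm (key x y) (key y x)

theorem abs_coord_sub_le (x y : Realization G) (c : V) :
    ENNReal.ofReal |x.coord c - y.coord c| ≤ edist x y := by
  have hx0 := x.coord_nonneg c
  have hx1 := x.coord_le_one c
  have hy0 := y.coord_nonneg c
  have hy1 := y.coord_le_one c
  refine le_edist (fun a b ha hb => ?_) (fun a b ha hb => ?_)
  · by_cases hab : a = b
    · subst hab
      rw [SimpleGraph.edist_self, ENat.toENNReal_zero, add_zero, ← ENNReal.ofReal_add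
        (by linarith [x.coord_le_one a]) (by linarith [y.coord_le_one a])]
      apply ENNReal.ofReal_le_ofReal
      by_cases hca : c = a
      · subst hca; rw [abs_le]; constructor <;> linarith
      · have := x.coord_add_le_one hca
        have := y.coord_add_le_one hca
        rw [abs_le]; constructor <;> linarith [x.coord_le_one a, y.coord_le_one a]
    · have h1 : (1 : ℝ≥0∞) ≤ (G.edist a b : ℝ≥0∞) := by
        have : (1 : ℕ∞) ≤ G.edist a b := by
          rw [Order.one_le_iff_ne_zero]; exact fun h => hab (SimpleGraph.edist_eq_zero_iff.1 h)
        simpa using ENat.toENNReal_le.2 this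
      have h2 : ENNReal.ofReal |x.coord c - y.coord c| ≤ 1 := by
        rw [ENNReal.ofReal_le_one, abs_le]; constructor <;> linarith
      exact (h2.trans h1).trans (le_add_right le_add_self)
  · apply ENNReal.ofReal_le_ofReal
    have hx := ha.add_eq
    have hy := hb.add_eq
    by_cases hca : c = a
    · rw [hca]
    · by_cases hcb : c = b
      · rw [hcb, show x.coord b - y.coord b = -(x.coord a - y.coord a) by linarith, abs_neg]
      · have h1 : x.coord c = 0 := by by_contra h; rcases ha.2 c h with h | h <;> contradiction
        have h2 : y.coord c = 0 := by by_contra h; rcases hb.2 c h with h | h <;> contradiction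
        simp [h1, h2]

theorem edist_ends_le (x : Realization G) {a b : V} (ha : x.coord a ≠ 0) (hb : x.coord b ≠ 0) :
    (G.edist a b : ℝ≥0∞) ≤ ENNReal.ofReal (1 - x.coord a) + ENNReal.ofReal (1 - x.coord b) := by
  by_cases hab : a = b
  · subst hab; simp
  · obtain ⟨h1, h2, -⟩ := x.coord_pair hab ha hb
    rw [SimpleGraph.edist_eq_one_iff_adj.2 h1, ← ENNReal.ofReal_add
        (by linarith [x.coord_le_one a]) (by linarith [x.coord_le_one b])]
    rw [show 1 - x.coord a + (1 - x.coord b) = 1 by linarith]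
    simp

/-- From `x`, along an edge, to `y` and then on to an end `b` of the edge of `y`. -/
theorem along_step (x y : Realization G) {a c b : V} (hx : x.OnEdge a c) (hy : y.OnEdge a c)
    (hb : y.coord b ≠ 0) : ∃ p, x.coord p ≠ 0 ∧
      ENNReal.ofReal (1 - x.coord p) + (G.edist p b : ℝ≥0∞) ≤
        ENNReal.ofReal |x.coord a - y.coord a| + ENNReal.ofReal (1 - y.coord b) := by
  wlog hba : b = a generalizing a c
  · have hbc : b = c := (hy.2 b hb).resolve_left hba
    have := this hx.symm hy.symm hbc
    have h1 := hx.add_eq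
    have h2 := hy.add_eq
    rwa [show x.coord c - y.coord c = -(x.coord a - y.coord a) by linarith, abs_neg] at this
  subst hba
  have h1 := hx.add_eq
  have hy1 := y.coord_le_one b
  have e := ENNReal.ofReal_add (abs_nonneg (x.coord b - y.coord b)) (sub_nonneg.2 hy1)
  rw [← e]
  have hle := neg_abs_le (x.coord b - y.coord b)
  by_cases hxb : x.coord b = 0
  · refine ⟨c, by intro h; linarith, ?_⟩
    rw [SimpleGraph.edist_eq_one_iff_adj.2 hx.1.symm, show 1 - x.coord c = 0 by linarith]
    simp only [ENNReal.ofReal_zero, ENat.toENNReal_one, zero_add]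
    rw [ENNReal.one_le_ofReal]; linarith
  · refine ⟨b, hxb, ?_⟩
    rw [SimpleGraph.edist_self, ENat.toENNReal_zero, add_zero]
    exact ENNReal.ofReal_le_ofReal (by linarith)

theorem edist_le_along_via (x y z : Realization G) {a c b d : V} (hx : x.OnEdge a c)
    (hy : y.OnEdge a c) (hb : y.coord b ≠ 0) (hd : z.coord d ≠ 0) :
    edist x z ≤ ENNReal.ofReal |x.coord a - y.coord a| + (ENNReal.ofReal (1 - y.coord b) +
      (G.edist b d : ℝ≥0∞) + ENNReal.ofReal (1 - z.coord d)) := by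
  obtain ⟨p, hp, hle⟩ := along_step x y hx hy hb
  have tri : (G.edist p d : ℝ≥0∞) ≤ (G.edist p b : ℝ≥0∞) + (G.edist b d : ℝ≥0∞) := by
    rw [← ENat.toENNReal_add]; exact ENat.toENNReal_le.2 SimpleGraph.edist_triangle
  calc edist x z ≤ _ := edist_le_via x z hp hd
    _ ≤ ENNReal.ofReal (1 - x.coord p) + ((G.edist p b : ℝ≥0∞) + (G.edist b d : ℝ≥0∞))
        + ENNReal.ofReal (1 - z.coord d) := by gcongr
    _ = (ENNReal.ofReal (1 - x.coord p) + (G.edist p b : ℝ≥0∞)) + (G.edist b d : ℝ≥0∞)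
        + ENNReal.ofReal (1 - z.coord d) := by ring
    _ ≤ (ENNReal.ofReal |x.coord a - y.coord a| + ENNReal.ofReal (1 - y.coord b))
        + (G.edist b d : ℝ≥0∞) + ENNReal.ofReal (1 - z.coord d) := by gcongr
    _ = _ := by ring

theorem le_edist_add {y z : Realization G} {r s : ℝ≥0∞}
    (h1 : ∀ a b, y.coord a ≠ 0 → z.coord b ≠ 0 →
      r ≤ s + (ENNReal.ofReal (1 - y.coord a) + (G.edist a b : ℝ≥0∞)
        + ENNReal.ofReal (1 - z.coord b)))
    (h2 : ∀ a b, y.OnEdge a b → z.OnEdge a b → r ≤ s + ENNReal.ofReal |y.coord a - z.coord a|) :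
    r ≤ s + edist y z := by
  have : r - s ≤ edist y z := by
    refine le_edist (fun a b ha hb => ?_) (fun a b ha hb => ?_)
    · exact tsub_le_iff_left.2 (h1 a b ha hb)
    · exact tsub_le_iff_left.2 (h2 a b ha hb)
  exact tsub_le_iff_left.1 this

protected theorem edist_triangle (x y z : Realization G) :
    edist x z ≤ edist x y + edist y z := by
  refine le_edist_add (fun b d hb hd => ?_) (fun b d hb hd => ?_)
  · rw [add_comm]
    refine le_edist_add (fun a c ha hc => ?_) (fun a c ha hc => ?_)
    · have tri : (G.edist a d : ℝ≥0∞) ≤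
          (G.edist a c : ℝ≥0∞) + ((G.edist c b : ℝ≥0∞) + (G.edist b d : ℝ≥0∞)) := by
        rw [← ENat.toENNReal_add, ← ENat.toENNReal_add]
        exact ENat.toENNReal_le.2 (SimpleGraph.edist_triangle.trans
          (by gcongr; exact SimpleGraph.edist_triangle))
      calc edist x z ≤ _ := edist_le_via x z ha hd
        _ ≤ ENNReal.ofReal (1 - x.coord a) + ((G.edist a c : ℝ≥0∞) +
            ((ENNReal.ofReal (1 - y.coord c) + ENNReal.ofReal (1 - y.coord b))
              + (G.edist b d : ℝ≥0∞))) + ENNReal.ofReal (1 - z.coord d) := by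
            refine add_le_add (add_le_add le_rfl (tri.trans ?_)) le_rfl
            gcongr
            exact edist_ends_le y hc hb
        _ = _ := by ring
    · rw [add_comm]; exact edist_le_along_via x y z ha hc hb hd
  · rw [add_comm]
    refine le_edist_add (fun a c ha hc => ?_) (fun a c ha hc => ?_)
    · have := edist_le_along_via z y x hd hb hc ha
      rw [Realization.edist_comm, abs_sub_comm]
      refine this.trans (le_of_eq ?_)
      rw [abs_sub_comm, abs_sub_comm (y.coord b), SimpleGraph.edist_comm]; ring
    · by_cases hy : ∃ e, y.coord e = 1
      · obtain ⟨e, he⟩ := hy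
        have he0 : y.coord e ≠ 0 := by rw [he]; exact one_ne_zero
        obtain ⟨p, hp, hle⟩ := along_step z y hd hb he0
        have := edist_le_along_via x y z ha hc he0 hp
        rw [he] at this hle
        simp only [sub_self, ENNReal.ofReal_zero, zero_add, add_zero] at this hle
        rw [add_comm, abs_sub_comm (y.coord b)]
        refine this.trans (add_le_add le_rfl (le_trans (le_of_eq ?_) hle))
        rw [SimpleGraph.edist_comm, add_comm]
      · push Not at hy
        have hya : y.coord a ≠ 0 := fun h => hy c (by linarith [hc.add_eq])
        have hyc : y.coord c ≠ 0 := fun h => hy a (by linarith [hc.add_eq])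
        have hac := ha.1.ne
        have key : ENNReal.ofReal |y.coord b - z.coord b| = ENNReal.ofReal |y.coord a - z.coord a|
            ∧ z.OnEdge a c := by
          rcases hb.2 a hya with h | h <;> rcases hb.2 c hyc with h' | h'
          · exact absurd (h.trans h'.symm) hac
          · subst h h'; exact ⟨rfl, hd⟩
          · subst h h'
            refine ⟨?_, hd.symm⟩
            rw [show y.coord c - z.coord c = -(y.coord a - z.coord a) by
              linarith [hb.add_eq, hd.add_eq], abs_neg]
          · exact absurd (h.trans h'.symm) hac
        rw [key.1]
        refine (edist_le_along x z ha key.2).trans ?_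
        rw [← ENNReal.ofReal_add (abs_nonneg _) (abs_nonneg _), add_comm]
        exact ENNReal.ofReal_le_ofReal (abs_sub_le _ _ _)

/-- The shortest-path distance is an (extended) metric. -/
noncomputable instance : EMetricSpace (Realization G) where
  edist_self x := by
    obtain ⟨c, hc⟩ := x.exists_coord_ne
    by_cases h : x.coord c = 1
    · have := edist_le_via x x hc hc
      simpa [h] using this
    · obtain ⟨d, hdc, hd⟩ : ∃ d, c ≠ d ∧ x.coord d ≠ 0 := by
        classical
        obtain ⟨x, a, b, t, hab, h0, h1, rfl⟩ := x
        by_contra! hh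
        have ha := hh a
        have hb := hh b
        simp only [coord, Finsupp.add_apply, Finsupp.single_apply] at ha hb h hc
        grind
      have hE := (x.coord_pair hdc hc hd).2.2
      simpa using edist_le_along x x hE hE
  edist_comm := Realization.edist_comm
  edist_triangle := Realization.edist_triangle
  eq_of_edist_eq_zero {x y} h := by
    refine Realization.ext (Finsupp.ext fun c => ?_)
    have := abs_coord_sub_le x y c
    rw [h, nonpos_iff_eq_zero, ENNReal.ofReal_eq_zero] at this
    exact sub_eq_zero.1 (abs_nonpos_iff.1 this)

/-- Between vertices, the distance is the graph distance. -/
theorem edist_vertex (a b : V) : edist (vertex G a) (vertex G b) = (G.edist a b : ℝ≥0∞) := by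
  classical
  have hc : ∀ a c : V, (vertex G a).coord c = if a = c then 1 else 0 := fun a c =>
    Finsupp.single_apply
  refine le_antisymm ?_ (le_edist (fun c d h1 h2 => ?_) (fun c d h1 h2 => ?_))
  · have := edist_le_via (vertex G a) (vertex G b) (a := a) (b := b) (by simp [hc]) (by simp [hc])
    simpa [hc] using this
  · have h1 : a = c := by by_contra h; simp [hc, h] at h1
    have h2 : b = d := by by_contra h; simp [hc, h] at h2
    subst h1 h2
    exact (le_add_right le_add_self)
  · have h3 := h1.1
    have e1 := h1.2 a (by simp [hc])
    have e2 := h2.2 b (by simp [hc])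
    rcases e1 with rfl | rfl <;> rcases e2 with rfl | rfl
    · simp
    · simp [hc, h3.ne', SimpleGraph.edist_eq_one_iff_adj.2 h3]
    · simp [hc, h3.ne', SimpleGraph.edist_eq_one_iff_adj.2 h3.symm]
    · simp

end Realization

/-- `S` is (the image of) a geodesic `[xy]`: a curve from `x` to `y` parametrized by arc length
and isometric to a compact interval. -/
def IsGeodesicSegment {X : Type u} [EMetricSpace X] (S : Set X) (x y : X) : Prop :=
  ∃ (L : ℝ) (γ : ℝ → X), 0 ≤ L ∧ γ 0 = x ∧ γ L = y ∧
    (∀ s ∈ Set.Icc 0 L, ∀ t ∈ Set.Icc 0 L, edist (γ s) (γ t) = ENNReal.ofReal |s - t|) ∧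
    S = γ '' Set.Icc 0 L

/-- `S` is contained in the `δ`-neighbourhood of `T`. -/
def InNeighborhood {X : Type u} [EMetricSpace X] (δ : ℝ≥0) (S T : Set X) : Prop :=
  ∀ p ∈ S, ∃ q ∈ T, edist p q ≤ δ

/-- Every geodesic triangle is `δ`-thin: each side lies in the `δ`-neighbourhood of the union of
the other two (the Rips condition). Points of one triangle are at finite distance, so on a graph
that is not connected this is the Rips condition with the same `δ` on every component. -/
def IsHyperbolicWith (X : Type u) [EMetricSpace X] (δ : ℝ≥0) : Prop :=
  ∀ (x y z : X) (A B C : Set X),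
    IsGeodesicSegment A x y → IsGeodesicSegment B y z → IsGeodesicSegment C z x →
      InNeighborhood δ A (B ∪ C) ∧ InNeighborhood δ B (C ∪ A) ∧ InNeighborhood δ C (A ∪ B)

/-- The graph `G`, with edges of length `1`, is Gromov hyperbolic. -/
def IsHyperbolic {V : Type u} (G : SimpleGraph V) : Prop :=
  ∃ δ : ℝ≥0, IsHyperbolicWith (Realization G) δ

/-- The graph `G`, with edges of length `1`, has finite diameter. -/
def IsBounded {V : Type u} (G : SimpleGraph V) : Prop :=
  Metric.ediam (Set.univ : Set (Realization G)) < ∞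

end GraphHyp

/-!
Everything takes place on vertices, where hyperbolicity amounts to Gromov's four-point condition
`FourPoint` for the distance of the graph: `IsHyperbolic.exists_fourPoint` and
`FourPoint.isHyperbolic` pass between it and the Rips condition on the realization.

A walk of length `n` in the direct product is a pair of walks of length `n` in the factors
(`hasWalk_directProduct`), and walks can be lengthened by two. Hence, on the points of equal parity
of a product of two geodesics, the distance of the product is that of the supremum norm. If both
factors are unbounded, the product contains arbitrarily large squares of this kind, whose midpoints
of sides violate the four-point condition (`FourPoint.bounded_or_bounded`). So one factor is
bounded.

Moreover both factors inherit the four-point condition (`FourPoint.left`). To see this for the first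
factor `G`, consider the part of the product over an edge `[w, w']` of the second factor.
* If there is an odd closed walk at `w`, then `a ↦ (a, w)` changes distances by a bounded amount.
* If there is none and `G` is bipartite, then `G` embeds isometrically: send `a` to `(a, w)` or
  `(a, w')` according to its colour.
* If there is none and `G` is not bipartite, that part of the product is the bipartite double cover
  of `G`. The two lifts of a vertex `m` on an odd closed walk are at finite distance from each other,
  so the four-point condition with base point `m` descends to `G`, and it implies the condition in
  general.
-/

namespace GraphHyp

/-! ### Walks of prescribed length -/

section Walks

variable {V W : Type*} {G : SimpleGraph V} {H : SimpleGraph W}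

/-- There is a walk of length exactly `n` from `a` to `b`. Distances in a direct product are
governed by this relation rather than by `SimpleGraph.dist`, because walks of the two factors have to
be traversed simultaneously. -/
def HasWalk (G : SimpleGraph V) (n : ℕ) (a b : V) : Prop :=
  ∃ p : G.Walk a b, p.length = n

theorem hasWalk_zero {a b : V} : HasWalk G 0 a b ↔ a = b :=
  ⟨fun ⟨p, hp⟩ => p.eq_of_length_eq_zero hp, fun h => h ▸ ⟨.nil, rfl⟩⟩

theorem hasWalk_succ {n : ℕ} {a b : V} :
    HasWalk G (n + 1) a b ↔ ∃ c, G.Adj a c ∧ HasWalk G n c b := by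
  constructor
  · rintro ⟨p, hp⟩
    cases p with
    | nil => simp at hp
    | cons h q => exact ⟨_, h, q, by simpa using hp⟩
  · rintro ⟨c, h, q, hq⟩
    exact ⟨.cons h q, by simp [hq]⟩

theorem hasWalk_of_adj {a b : V} (h : G.Adj a b) : HasWalk G 1 a b :=
  ⟨h.toWalk, rfl⟩

theorem HasWalk.symm {n : ℕ} {a b : V} : HasWalk G n a b → HasWalk G n b a :=
  fun ⟨p, hp⟩ => ⟨p.reverse, by simpa using hp⟩

theorem HasWalk.trans {m n : ℕ} {a b c : V} :
    HasWalk G m a b → HasWalk G n b c → HasWalk G (m + n) a c :=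
  fun ⟨p, hp⟩ ⟨q, hq⟩ => ⟨p.append q, by simp [hp, hq]⟩

theorem HasWalk.dist_le {n : ℕ} {a b : V} : HasWalk G n a b → G.dist a b ≤ n :=
  fun ⟨p, hp⟩ => hp ▸ SimpleGraph.dist_le p

theorem HasWalk.reachable {n : ℕ} {a b : V} : HasWalk G n a b → G.Reachable a b :=
  fun ⟨p, _⟩ => p.reachable

theorem hasWalk_dist {a b : V} (h : G.Reachable a b) : HasWalk G (G.dist a b) a b :=
  h.exists_walk_length_eq_dist

/-- A walk is lengthened by any even number by running back and forth along an edge. -/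
theorem HasWalk.lengthen {m n : ℕ} {a b c : V} (h : HasWalk G n a b) (hbc : G.Adj b c)
    (hnm : n ≤ m) (he : Even (n + m)) : HasWalk G m a b := by
  have key : ∀ k, HasWalk G (n + 2 * k) a b := by
    intro k
    induction k with
    | zero => exact h
    | succ k ih => exact (ih.trans (hasWalk_of_adj hbc)).trans (hasWalk_of_adj hbc.symm)
  obtain ⟨r, hr⟩ := he
  obtain rfl : m = n + 2 * (r - n) := by omega
  exact key _

theorem hasWalk_directProduct {n : ℕ} {p q : V × W} :
    HasWalk (directProduct G H) n p q ↔ HasWalk G n p.1 q.1 ∧ HasWalk H n p.2 q.2 := by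
  induction n generalizing p with
  | zero => simp [hasWalk_zero, Prod.ext_iff]
  | succ n ih =>
    simp only [hasWalk_succ, ih]
    constructor
    · rintro ⟨c, hc, h1, h2⟩
      exact ⟨⟨c.1, hc.1, h1⟩, c.2, hc.2, h2⟩
    · rintro ⟨⟨a, ha, h1⟩, b, hb, h2⟩
      exact ⟨(a, b), ⟨ha, hb⟩, h1, h2⟩

theorem dist_fst_le {p q : V × W} (h : (directProduct G H).Reachable p q) :
    G.dist p.1 q.1 ≤ (directProduct G H).dist p q :=
  (hasWalk_directProduct.1 (hasWalk_dist h)).1.dist_le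

theorem dist_snd_le {p q : V × W} (h : (directProduct G H).Reachable p q) :
    H.dist p.2 q.2 ≤ (directProduct G H).dist p q :=
  (hasWalk_directProduct.1 (hasWalk_dist h)).2.dist_le

theorem dist_directProduct_swap (p q : V × W) :
    (directProduct H G).dist p.swap q.swap = (directProduct G H).dist p q := by
  have h : ∀ n, HasWalk (directProduct H G) n p.swap q.swap ↔ HasWalk (directProduct G H) n p q :=
    fun n => by simp [hasWalk_directProduct, and_comm]
  by_cases hr : (directProduct G H).Reachable p q
  · have h1 := (h _).2 (hasWalk_dist hr)
    exact le_antisymm h1.dist_le ((h _).1 (hasWalk_dist h1.reachable)).dist_le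
  · rw [SimpleGraph.dist_eq_zero_of_not_reachable hr, SimpleGraph.dist_eq_zero_of_not_reachable]
    exact fun hr' => hr ((h _).1 (hasWalk_dist hr')).reachable

/-- `f 0, …, f N` are the consecutive vertices of a geodesic; past `N` the sequence `f` may do
anything. -/
def IsGeodesicSeq (G : SimpleGraph V) (f : ℕ → V) (N : ℕ) : Prop :=
  ∀ i j, i ≤ j → j ≤ N → HasWalk G (j - i) (f i) (f j) ∧ G.dist (f i) (f j) = j - i

theorem IsGeodesicSeq.adj {f : ℕ → V} {N i : ℕ} (h : IsGeodesicSeq G f N) (hi : i < N) :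
    G.Adj (f i) (f (i + 1)) := by
  have := (h i (i + 1) (by omega) hi).2
  rwa [Nat.add_sub_cancel_left, SimpleGraph.dist_eq_one_iff_adj] at this

/-- The vertices of a walk whose length is the distance of its ends form a geodesic. -/
theorem isGeodesicSeq_getVert {a b : V} (p : G.Walk a b) (hp : p.length = G.dist a b) :
    IsGeodesicSeq G p.getVert p.length := by
  have walk : ∀ i k, i + k ≤ p.length → HasWalk G k (p.getVert i) (p.getVert (i + k)) := by
    intro i k
    induction k with
    | zero => exact fun _ => hasWalk_zero.2 rfl
    | succ k ih =>
      exact fun h => (ih (by omega)).trans (hasWalk_of_adj (p.adj_getVert_succ (by omega)))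
  intro i j hij hj
  have h1 := walk i (j - i) (by omega)
  have h0 := walk 0 i (by omega)
  have h2 := walk j (p.length - j) (by omega)
  rw [Nat.add_sub_of_le hij] at h1
  rw [Nat.add_sub_of_le hj, p.getVert_length] at h2
  rw [Nat.zero_add, p.getVert_zero] at h0
  refine ⟨h1, le_antisymm h1.dist_le ?_⟩
  have := (h0.trans ((hasWalk_dist h1.reachable).trans h2)).dist_le
  omega

theorem exists_isGeodesicSeq {a b : V} (h : G.Reachable a b) :
    ∃ f, f 0 = a ∧ f (G.dist a b) = b ∧ IsGeodesicSeq G f (G.dist a b) := by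
  obtain ⟨p, hp⟩ := h.exists_walk_length_eq_dist
  exact ⟨p.getVert, p.getVert_zero, hp ▸ p.getVert_length, hp ▸ isGeodesicSeq_getVert p hp⟩

end Walks

/-! ### The four-point condition on vertices -/

section FourPoint

variable {V W : Type*} {G : SimpleGraph V} {H : SimpleGraph W}

/-- Gromov's four-point condition for the vertices of `G`, required within each component. The
constant is `2δ` in the usual notation. -/
def FourPoint (G : SimpleGraph V) (C : ℕ) : Prop :=
  ∀ x y z w, G.Reachable x y → G.Reachable x z → G.Reachable x w →
    G.dist x y + G.dist z w ≤
      max (G.dist x z + G.dist y w) (G.dist y z + G.dist x w) + C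

theorem FourPoint.directProduct_swap {C : ℕ} (h : FourPoint (directProduct G H) C) :
    FourPoint (directProduct H G) C := by
  have hr : ∀ p q, (directProduct H G).Reachable p q →
      (directProduct G H).Reachable p.swap q.swap := fun p q hpq =>
    (hasWalk_directProduct.2 (hasWalk_directProduct.1 (hasWalk_dist hpq)).symm).reachable
  intro x y z w h1 h2 h3
  simpa only [dist_directProduct_swap] using
    h x.swap y.swap z.swap w.swap (hr _ _ h1) (hr _ _ h2) (hr _ _ h3)

/-- The four-point condition follows from its instances that involve a fixed vertex `m`. -/
theorem fourPoint_of_base {C : ℕ} (m : V)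
    (h : ∀ x y z, G.dist x z + G.dist y m ≤
      max (G.dist x y + G.dist z m) (G.dist y z + G.dist x m) + C) :
    FourPoint G (2 * C) := by
  intro x y z w _ _ _
  have h1 := h x z y
  have h2 := h x w y
  have h3 := h z x w
  have h4 := h z y w
  have e : ∀ a b, G.dist a b = G.dist b a := fun a b => SimpleGraph.dist_comm
  rw [e z y] at h1
  rw [e w y] at h2
  rw [e z x] at h3
  rw [e z y] at h4
  omega

/-- The four-point condition pulls back along a map that changes distances by a bounded amount. -/
theorem FourPoint.comap {K : SimpleGraph W} {C c : ℕ} (hK : FourPoint K C) (f : V → W)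
    (hr : ∀ a b, K.Reachable (f a) (f b)) (h1 : ∀ a b, G.dist a b ≤ K.dist (f a) (f b))
    (h2 : ∀ a b, K.dist (f a) (f b) ≤ G.dist a b + c) : FourPoint G (C + 2 * c) := by
  intro x y z w _ _ _
  have := hK (f x) (f y) (f z) (f w) (hr _ _) (hr _ _) (hr _ _)
  have := h1 x y
  have := h1 z w
  have := h2 x z
  have := h2 y w
  have := h2 y z
  have := h2 x w
  omega

end FourPoint

/-! ### A factor of a hyperbolic product is hyperbolic -/

section Factor

variable {V W : Type*} {G : SimpleGraph V} {H : SimpleGraph W}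

/-- The walk `w, w', w, w', …` along an edge. -/
def alternate (w w' : W) (i : ℕ) : W := if Even i then w else w'

theorem hasWalk_alternate {w w' : W} (hw : H.Adj w w') (i n : ℕ) :
    HasWalk H n (alternate w w' i) (alternate w w' (i + n)) := by
  induction n with
  | zero => exact hasWalk_zero.2 rfl
  | succ n ih =>
    refine ih.trans (hasWalk_of_adj ?_)
    by_cases h : Even (i + n)
    · simpa [alternate, h, ← add_assoc, Nat.even_add_one] using hw
    · simpa [alternate, h, ← add_assoc, Nat.even_add_one] using hw.symm

/-- If no closed walk at `w` has odd length, then over the edge `[w, w']` the product is the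
bipartite double cover of `G`: walks are walks of `G` of the right parity. -/
theorem hasWalk_lift {w w' : W} (hw : H.Adj w w') (hodd : ∀ n, HasWalk H n w w → Even n)
    {n i j : ℕ} {a b : V} :
    HasWalk (directProduct G H) n (a, alternate w w' i) (b, alternate w w' j) ↔
      HasWalk G n a b ∧ Even (n + i + j) := by
  rw [hasWalk_directProduct]
  refine and_congr_right fun _ => ⟨fun h => ?_, fun h => ?_⟩
  · have hi := hasWalk_alternate hw 0 i
    have hj := hasWalk_alternate hw 0 j
    simp only [zero_add] at hi hj
    have := hodd _ ((hi.trans h).trans hj.symm)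
    rwa [show i + n + j = n + i + j by ring] at this
  · have := hasWalk_alternate hw i n
    rwa [show alternate w w' (i + n) = alternate w w' j by
      have : Even (i + n) ↔ Even j := by simp only [Nat.even_add] at h ⊢; tauto
      simp [alternate, this]] at this

theorem FourPoint.left_of_odd_right (hG : G.Connected) [Nontrivial V] {w w' : W}
    (hw : H.Adj w w') {C c : ℕ} (hK : FourPoint (directProduct G H) C) (hc : HasWalk H c w w)
    (hodd : Odd c) : FourPoint G (C + 2 * c) := by
  -- The extra `c` makes room for the odd closed walk when the distance in `G` is odd.
  have walk : ∀ a b, ∃ n ≤ G.dist a b + c, HasWalk (directProduct G H) n (a, w) (b, w) := by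
    intro a b
    by_cases he : Even (G.dist a b)
    · exact ⟨G.dist a b, by omega, hasWalk_directProduct.2 ⟨hasWalk_dist (hG a b),
        (hasWalk_zero.2 rfl).lengthen hw (by omega) (by simpa using he)⟩⟩
    · obtain ⟨b', hb'⟩ := hG.preconnected.exists_adj_of_nontrivial b
      obtain ⟨k, hk⟩ := Nat.not_even_iff_odd.1 he
      obtain ⟨l, hl⟩ := hodd
      refine ⟨G.dist a b + 2 * l, by omega, hasWalk_directProduct.2 ⟨?_, ?_⟩⟩
      · exact (hasWalk_dist (hG a b)).lengthen hb' (by omega) ⟨G.dist a b + l, by ring⟩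
      · exact hc.lengthen hw (by omega) ⟨k + 2 * l + 1, by omega⟩
  refine hK.comap (fun a => (a, w)) (fun a b => ?_) (fun a b => ?_) (fun a b => ?_)
  · obtain ⟨n, -, hn⟩ := walk a b
    exact hn.reachable
  · obtain ⟨n, -, hn⟩ := walk a b
    exact dist_fst_le hn.reachable
  · obtain ⟨n, hle, hn⟩ := walk a b
    exact hn.dist_le.trans hle

theorem FourPoint.left_of_bipartite (hG : G.Connected) {w w' : W}
    (hw : H.Adj w w') {C : ℕ} (hK : FourPoint (directProduct G H) C)
    (hodd : ∀ n, HasWalk H n w w → Even n) (m : V) (hodd' : ∀ n, HasWalk G n m m → Even n) :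
    FourPoint G C := by
  have walk : ∀ a b, HasWalk (directProduct G H) (G.dist a b) (a, alternate w w' (G.dist m a))
      (b, alternate w w' (G.dist m b)) := by
    intro a b
    refine (hasWalk_lift hw hodd).2 ⟨hasWalk_dist (hG a b), ?_⟩
    have := hodd' _ (((hasWalk_dist (hG m a)).trans (hasWalk_dist (hG a b))).trans
      (hasWalk_dist (hG m b)).symm)
    rwa [add_comm (G.dist m a)] at this
  exact hK.comap (c := 0) (fun a => (a, alternate w w' (G.dist m a)))
    (fun a b => (walk a b).reachable) (fun a b => dist_fst_le (walk a b).reachable)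
    (fun a b => (walk a b).dist_le)

/-- A graph with an odd closed walk inherits hyperbolicity from its bipartite double cover. A
vertex `m` on an odd closed walk has two lifts at finite distance from each other, so that all
lifts of `x` are at distance `d(x, m)` from the lifts of `m`, up to a constant. As the lifts of
`x`, `y`, `z` can be chosen such that `d(x, y)` and `d(y, z)` are attained, the condition with
base point `m` goes down to `G`. -/
theorem FourPoint.left_of_odd_left (hG : G.Connected) {w w' : W}
    (hw : H.Adj w w') {C c : ℕ} (hK : FourPoint (directProduct G H) C)
    (hodd : ∀ n, HasWalk H n w w → Even n) {m : V} (hc : HasWalk G c m m) (hcodd : Odd c) :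
    FourPoint G (2 * (C + c)) := by
  have attained : ∀ a b i, HasWalk (directProduct G H) (G.dist a b) (a, alternate w w' i)
      (b, alternate w w' (i + G.dist a b)) := fun a b i =>
    (hasWalk_lift hw hodd).2 ⟨hasWalk_dist (hG a b), ⟨G.dist a b + i, by ring⟩⟩
  have base : ∀ a i, ∃ n ≤ G.dist a m + c, HasWalk (directProduct G H) n
      (a, alternate w w' i) (m, alternate w w' 0) := by
    intro a i
    by_cases he : Even (G.dist a m + i)
    · exact ⟨G.dist a m, by omega, (hasWalk_lift hw hodd).2 ⟨hasWalk_dist (hG a m), he⟩⟩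
    · refine ⟨G.dist a m + c, le_rfl, (hasWalk_lift hw hodd).2
        ⟨(hasWalk_dist (hG a m)).trans hc, ?_⟩⟩
      rw [show G.dist a m + c + i + 0 = (G.dist a m + i) + c by ring]
      exact (Nat.not_even_iff_odd.1 he).add_odd hcodd
  refine fourPoint_of_base m fun x y z => ?_
  have h1 := attained x y 0
  have h2 := attained y z (0 + G.dist x y)
  obtain ⟨n, hn, h3⟩ := base x 0
  obtain ⟨n', hn', h4⟩ := base y (0 + G.dist x y)
  obtain ⟨n'', hn'', h5⟩ := base z (0 + G.dist x y + G.dist y z)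
  have h6 := (h1.trans h2).reachable
  have key := hK _ _ _ _ h6 h1.reachable h3.reachable
  rw [SimpleGraph.dist_comm (u := (z, _)) (v := (y, _))] at key
  have := dist_fst_le h6
  have := dist_fst_le h4.reachable
  have := h1.dist_le
  have := h2.dist_le
  have := h3.dist_le
  have := h5.dist_le
  simp only at *
  omega

theorem FourPoint.left (hG : G.Connected) (hH : H.Connected) [Nontrivial V] [Nontrivial W] {C : ℕ}
    (hK : FourPoint (directProduct G H) C) : ∃ C', FourPoint G C' := by
  obtain ⟨m⟩ := hG.nonempty
  obtain ⟨w⟩ := hH.nonempty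
  obtain ⟨w', hw⟩ := hH.preconnected.exists_adj_of_nontrivial w
  by_cases h : ∀ n, HasWalk H n w w → Even n
  · by_cases h' : ∀ n, HasWalk G n m m → Even n
    · exact ⟨_, hK.left_of_bipartite hG hw h m h'⟩
    · push Not at h'
      obtain ⟨c, hc, hodd⟩ := h'
      exact ⟨_, hK.left_of_odd_left hG hw h hc (Nat.not_even_iff_odd.1 hodd)⟩
  · push Not at h
    obtain ⟨c, hc, hodd⟩ := h
    exact ⟨_, hK.left_of_odd_right hG hw hc (Nat.not_even_iff_odd.1 hodd)⟩

end Factor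

/-! ### Large squares in a product of unbounded graphs -/

section Square

variable {V W : Type*} {G : SimpleGraph V} {H : SimpleGraph W}

theorem IsGeodesicSeq.hasWalk {f : ℕ → V} {N : ℕ} (hf : IsGeodesicSeq G f N) (hN : 0 < N)
    {i i' n : ℕ} (hi : i ≤ N) (hi' : i' ≤ N) (h1 : i ≤ i' + n) (h2 : i' ≤ i + n)
    (he : Even (n + i + i')) : HasWalk G n (f i) (f i') := by
  obtain ⟨c, hc⟩ : ∃ c, G.Adj (f i') c := by
    rcases Nat.lt_or_ge i' N with h | h
    · exact ⟨_, hf.adj h⟩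
    · obtain ⟨k, rfl⟩ : ∃ k, i' = k + 1 := ⟨i' - 1, by omega⟩
      exact ⟨_, (hf.adj (by omega)).symm⟩
  obtain ⟨r, hr⟩ := he
  rcases le_total i i' with h | h
  · exact (hf i i' h hi').1.lengthen hc (by omega) ⟨r - i, by omega⟩
  · exact (hf i' i h hi).1.symm.lengthen hc (by omega) ⟨r - i', by omega⟩

/-- On the points of equal parity of a product of two geodesics, the distance is that of the
supremum norm: this is the upper bound. -/
theorem hasWalk_grid {f : ℕ → V} {g : ℕ → W} {N M : ℕ} (hf : IsGeodesicSeq G f N)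
    (hg : IsGeodesicSeq H g M) (hN : 0 < N) (hM : 0 < M) {i i' j j' n : ℕ} (hi : i ≤ N)
    (hi' : i' ≤ N) (hj : j ≤ M) (hj' : j' ≤ M) (h1 : i ≤ i' + n) (h2 : i' ≤ i + n)
    (h3 : j ≤ j' + n) (h4 : j' ≤ j + n) (h5 : Even (n + i + i')) (h6 : Even (n + j + j')) :
    HasWalk (directProduct G H) n (f i, g j) (f i', g j') :=
  hasWalk_directProduct.2 ⟨hf.hasWalk hN hi hi' h1 h2 h5, hg.hasWalk hM hj hj' h3 h4 h6⟩

/-- The midpoints of the sides of a large square in a product of two geodesics violate the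
four-point condition: opposite ones are twice as far apart as neighbouring ones. The side length is
a multiple of `4`, so that the midpoints have the same parity. -/
theorem FourPoint.bounded_or_bounded (hG : G.Connected) (hH : H.Connected) {C : ℕ}
    (hK : FourPoint (directProduct G H) C) :
    (∃ N, ∀ a b, G.dist a b ≤ N) ∨ (∃ N, ∀ a b, H.dist a b ≤ N) := by
  by_contra! hcon
  obtain ⟨h1, h2⟩ := hcon
  obtain ⟨a, b, hab⟩ := h1 (4 * (C + 1))
  obtain ⟨a', b', hab'⟩ := h2 (4 * (C + 1))
  obtain ⟨f, -, -, hf⟩ := exists_isGeodesicSeq (hG a b)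
  obtain ⟨g, -, -, hg⟩ := exists_isGeodesicSeq (hH a' b')
  generalize G.dist a b = N at hab hf
  generalize H.dist a' b' = M at hab' hg
  have walk := fun {i i' j j' n} hi hi' hj hj' => hasWalk_grid hf hg (by omega) (by omega)
    (i := i) (i' := i') (j := j) (j' := j') (n := n) hi hi' hj hj'
  have far1 : HasWalk (directProduct G H) (4 * (C + 1)) (f 0, g (2 * (C + 1)))
      (f (4 * (C + 1)), g (2 * (C + 1))) := by
    apply walk <;> first | omega | (simp only [Nat.even_iff]; omega)
  have far2 : HasWalk (directProduct G H) (4 * (C + 1)) (f (2 * (C + 1)), g 0)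
      (f (2 * (C + 1)), g (4 * (C + 1))) := by
    apply walk <;> first | omega | (simp only [Nat.even_iff]; omega)
  have near1 : HasWalk (directProduct G H) (2 * (C + 1)) (f 0, g (2 * (C + 1)))
      (f (2 * (C + 1)), g 0) := by
    apply walk <;> first | omega | (simp only [Nat.even_iff]; omega)
  have near2 : HasWalk (directProduct G H) (2 * (C + 1)) (f (4 * (C + 1)), g (2 * (C + 1)))
      (f (2 * (C + 1)), g (4 * (C + 1))) := by
    apply walk <;> first | omega | (simp only [Nat.even_iff]; omega)
  have near3 : HasWalk (directProduct G H) (2 * (C + 1)) (f (4 * (C + 1)), g (2 * (C + 1)))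
      (f (2 * (C + 1)), g 0) := by
    apply walk <;> first | omega | (simp only [Nat.even_iff]; omega)
  have near4 : HasWalk (directProduct G H) (2 * (C + 1)) (f 0, g (2 * (C + 1)))
      (f (2 * (C + 1)), g (4 * (C + 1))) := by
    apply walk <;> first | omega | (simp only [Nat.even_iff]; omega)
  have key := hK _ _ _ _ far1.reachable near1.reachable near4.reachable
  have l1 := dist_fst_le far1.reachable
  have l2 := dist_snd_le far2.reachable
  have e1 := (hf 0 (4 * (C + 1)) (by omega) (by omega)).2
  have e2 := (hg 0 (4 * (C + 1)) (by omega) (by omega)).2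
  have := near1.dist_le
  have := near2.dist_le
  have := near3.dist_le
  have := near4.dist_le
  simp only at *
  omega

end Square

/-! ### Geodesics in the realization -/

section Realization

open Realization

variable {V : Type*} {G : SimpleGraph V}

/-- The point at distance `t` from `a` on the edge `[a, b]`; the degenerate edge `a = b` is
allowed, so that eventually constant sequences of vertices are covered. -/
noncomputable def edgePoint {a b : V} (h : a = b ∨ G.Adj a b) (t : ℝ) (h0 : 0 ≤ t) (h1 : t ≤ 1) :
    Realization G :=
  ⟨Finsupp.single a (1 - t) + Finsupp.single b t, a, b, t, h, h0, h1, rfl⟩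

theorem edist_edgePoint_le {a b : V} (h : a = b ∨ G.Adj a b) {s t : ℝ} (hs0 : 0 ≤ s) (hs1 : s ≤ 1)
    (ht0 : 0 ≤ t) (ht1 : t ≤ 1) :
    edist (edgePoint h s hs0 hs1) (edgePoint h t ht0 ht1) ≤ ENNReal.ofReal |s - t| := by
  classical
  rcases h with rfl | h
  · have : edgePoint (G := G) (a := a) (b := a) (.inl rfl) s hs0 hs1 =
        edgePoint (a := a) (b := a) (.inl rfl) t ht0 ht1 := by
      ext1
      simp [edgePoint]
    simp [this]
  · have on : ∀ (r : ℝ) (h0 : 0 ≤ r) (h1 : r ≤ 1), (edgePoint (.inr h) r h0 h1).OnEdge a b := by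
      refine fun r h0 h1 => ⟨h, fun c hc => ?_⟩
      by_contra! hne
      simp [edgePoint, coord, hne.1.symm, hne.2.symm] at hc
    refine (edist_le_along _ _ (on s hs0 hs1) (on t ht0 ht1)).trans (le_of_eq ?_)
    simp only [edgePoint, coord, Finsupp.add_apply, Finsupp.single_apply, h.ne', if_true, if_false,
      add_zero]
    rw [show 1 - s - (1 - t) = -(s - t) by ring, abs_neg]

/-- The curve of unit speed through the vertices `f 0, f 1, …`. For `t < 0` its value is
irrelevant. -/
noncomputable def polygon (f : ℕ → V) (hf : ∀ i, f i = f (i + 1) ∨ G.Adj (f i) (f (i + 1)))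
    (t : ℝ) : Realization G :=
  edgePoint (hf ⌊t⌋₊) (Int.fract t) (Int.fract_nonneg t) (Int.fract_lt_one t).le

variable {f : ℕ → V} {hf : ∀ i, f i = f (i + 1) ∨ G.Adj (f i) (f (i + 1))}

theorem polygon_eq_edgePoint (i : ℕ) {t : ℝ} (h0 : i ≤ t) (h1 : t ≤ i + 1) :
    polygon f hf t = edgePoint (hf i) (t - i) (by linarith) (by linarith) := by
  rcases h1.lt_or_eq with h1 | rfl
  · have hi : ⌊t⌋₊ = i := (Nat.floor_eq_iff (i.cast_nonneg.trans h0)).2 ⟨h0, h1⟩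
    have ht : Int.fract t = t - i := by
      rw [Int.fract_eq_iff]
      exact ⟨by linarith, by linarith, i, by simp⟩
    ext1
    simp [polygon, edgePoint, hi, ht]
  · have hi : ⌊(i : ℝ) + 1⌋₊ = i + 1 := by
      exact_mod_cast Nat.floor_natCast (R := ℝ) (i + 1)
    have ht : Int.fract ((i : ℝ) + 1) = 0 := by simp
    ext1
    simp [polygon, edgePoint, hi, ht]

theorem polygon_natCast (i : ℕ) : polygon f hf i = vertex G (f i) := by
  ext1
  simp [polygon, edgePoint, vertex]

theorem edist_polygon_le {s t : ℝ} (hs : 0 ≤ s) (hst : s ≤ t) :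
    edist (polygon f hf s) (polygon f hf t) ≤ ENNReal.ofReal (t - s) := by
  have cell : ∀ (i : ℕ) (s t : ℝ), i ≤ s → s ≤ t → t ≤ i + 1 →
      edist (polygon f hf s) (polygon f hf t) ≤ ENNReal.ofReal (t - s) := by
    intro i s t h1 h2 h3
    rw [polygon_eq_edgePoint i h1 (h2.trans h3), polygon_eq_edgePoint i (h1.trans h2) h3]
    refine (edist_edgePoint_le ..).trans (le_of_eq ?_)
    rw [abs_sub_comm, sub_sub_sub_cancel_right, abs_of_nonneg (by linarith)]
  have key : ∀ (k i : ℕ) (s t : ℝ), i ≤ s → s ≤ i + 1 → s ≤ t → t ≤ i + k + 1 →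
      edist (polygon f hf s) (polygon f hf t) ≤ ENNReal.ofReal (t - s) := by
    intro k
    induction k with
    | zero => exact fun i s t h1 _ h3 h4 => cell i s t h1 h3 (by simpa using h4)
    | succ k ih =>
      intro i s t h1 h2 h3 h4
      rcases le_total t (i + 1) with h | h
      · exact cell i s t h1 h3 h
      · have a1 := cell i s (i + 1) h1 h2 le_rfl
        have a2 := ih (i + 1) (i + 1) t (by push_cast; rfl) (by push_cast; linarith) h
          (by push_cast at h4 ⊢; linarith)
        refine (edist_triangle _ (polygon f hf (i + 1)) _).trans ((add_le_add a1 a2).trans ?_)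
        rw [← ENNReal.ofReal_add (by linarith) (by linarith)]
        exact ENNReal.ofReal_le_ofReal (by linarith)
  have h1 := Nat.floor_le hs
  have h2 := (Nat.lt_floor_add_one s).le
  have h3 := (Nat.lt_floor_add_one t).le
  exact key ⌊t⌋₊ ⌊s⌋₊ s t h1 h2 hst (by linarith [(⌊s⌋₊ : ℕ).cast_nonneg (α := ℝ)])

/-- A curve of unit speed whose ends are as far apart as its length is a geodesic. -/
theorem isGeodesicSegment_polygon {N : ℕ} (hN : G.edist (f 0) (f N) = N) :
    IsGeodesicSegment (polygon f hf '' Set.Icc 0 (N : ℝ)) (vertex G (f 0)) (vertex G (f N)) := by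
  refine ⟨N, polygon f hf, N.cast_nonneg, ?_, polygon_natCast N, ?_, rfl⟩
  · exact_mod_cast polygon_natCast (hf := hf) 0
  have key : ∀ s t : ℝ, 0 ≤ s → s ≤ t → t ≤ N →
      edist (polygon f hf s) (polygon f hf t) = ENNReal.ofReal (t - s) := by
    intro s t hs hst ht
    refine le_antisymm (edist_polygon_le hs hst) ?_
    have e0 : edist (polygon f hf (0 : ℕ)) (polygon f hf N) = ENNReal.ofReal N := by
      rw [polygon_natCast, polygon_natCast, edist_vertex, hN]
      simp
    have e1 := edist_polygon_le (f := f) (hf := hf) le_rfl hs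
    have e2 := edist_polygon_le (f := f) (hf := hf) (hs.trans hst) ht
    have tri := (edist_triangle4 (polygon f hf (0 : ℕ)) (polygon f hf s) (polygon f hf t)
      (polygon f hf N))
    rw [e0] at tri
    rw [Nat.cast_zero] at tri
    have h := tri.trans (add_le_add (add_le_add e1 le_rfl) e2)
    have hfin : edist (polygon f hf s) (polygon f hf t) ≠ ⊤ :=
      ((edist_polygon_le hs hst).trans_lt ENNReal.ofReal_lt_top).ne
    rw [← ENNReal.ofReal_toReal hfin] at h ⊢
    rw [← ENNReal.ofReal_add (by linarith) ENNReal.toReal_nonneg,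
      ← ENNReal.ofReal_add (add_nonneg (by linarith) ENNReal.toReal_nonneg) (by linarith),
      ENNReal.ofReal_le_ofReal_iff
        (add_nonneg (add_nonneg (by linarith) ENNReal.toReal_nonneg) (by linarith))] at h
    exact ENNReal.ofReal_le_ofReal (by linarith)
  intro s hs t ht
  rcases le_total s t with h | h
  · rw [key s t hs.1 h ht.2, abs_sub_comm, abs_of_nonneg (by linarith)]
  · rw [edist_comm, key t s ht.1 h hs.2, abs_of_nonneg (by linarith)]

/-- A walk of minimal length carries a geodesic of the realization through its vertices, all of
whose points are within distance `1` of a vertex of the walk. -/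
theorem exists_isGeodesicSegment {a b : V} (p : G.Walk a b) (hp : p.length = G.dist a b) :
    ∃ S, IsGeodesicSegment S (vertex G a) (vertex G b) ∧
      (∀ i ≤ p.length, vertex G (p.getVert i) ∈ S) ∧
      ∀ x ∈ S, ∃ i ≤ p.length, edist x (vertex G (p.getVert i)) ≤ 1 := by
  have hf : ∀ i, p.getVert i = p.getVert (i + 1) ∨ G.Adj (p.getVert i) (p.getVert (i + 1)) := by
    intro i
    rcases lt_or_ge i p.length with h | h
    · exact .inr (p.adj_getVert_succ h)
    · exact .inl (by rw [p.getVert_of_length_le h, p.getVert_of_length_le (by omega)])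
  refine ⟨polygon p.getVert hf '' Set.Icc 0 (p.length : ℝ), ?_, fun i hi => ?_, ?_⟩
  · have := isGeodesicSegment_polygon (f := p.getVert) (hf := hf) (N := p.length)
      (by rw [p.getVert_zero, p.getVert_length, hp, p.reachable.coe_dist_eq_edist])
    rwa [p.getVert_zero, p.getVert_length] at this
  · exact ⟨i, ⟨i.cast_nonneg, by exact_mod_cast hi⟩, polygon_natCast i⟩
  · rintro _ ⟨t, ht, rfl⟩
    refine ⟨⌊t⌋₊, Nat.floor_le_of_le ht.2, ?_⟩
    rw [← polygon_natCast (hf := hf), edist_comm]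
    refine (edist_polygon_le (Nat.cast_nonneg _) (Nat.floor_le ht.1)).trans ?_
    rw [ENNReal.ofReal_le_one]
    linarith [Nat.lt_floor_add_one t]

end Realization

/-! ### Thin triangles imply the four-point condition -/

section ThinToFourPoint

open Realization

variable {V : Type*} {G : SimpleGraph V}

/-- A discrete consequence of the Rips condition: a vertex `p` between `x` and `y` is, up to `D`,
between `x` and `z` or between `y` and `z`. -/
def ThinIntervals (G : SimpleGraph V) (D : ℕ) : Prop :=
  ∀ x y z p, G.Reachable x z → G.Reachable x p → G.Reachable p y →
    G.dist x p + G.dist p y = G.dist x y →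
      G.dist x p + G.dist p z ≤ G.dist x z + D ∨ G.dist y p + G.dist p z ≤ G.dist y z + D

theorem IsHyperbolicWith.thinIntervals {δ : ℝ≥0} (h : IsHyperbolicWith (Realization G) δ) :
    ThinIntervals G (2 * (⌈δ⌉₊ + 1)) := by
  intro x y z p hxz hxp hpy hp
  obtain ⟨P, hP⟩ := hxp.exists_walk_length_eq_dist
  obtain ⟨Q, hQ⟩ := hpy.exists_walk_length_eq_dist
  obtain ⟨R, hR⟩ := ((hxp.trans hpy).symm.trans hxz).exists_walk_length_eq_dist
  obtain ⟨T, hT⟩ := hxz.symm.exists_walk_length_eq_dist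
  obtain ⟨A, hA, hA', -⟩ := exists_isGeodesicSegment (P.append Q) (by simp [hP, hQ, hp])
  obtain ⟨B, hB, -, hB'⟩ := exists_isGeodesicSegment R hR
  obtain ⟨C, hC, -, hC'⟩ := exists_isGeodesicSegment T hT
  have hpA : vertex G p ∈ A := by
    have := hA' P.length (by simp)
    rwa [SimpleGraph.Walk.getVert_append, if_neg (lt_irrefl _), Nat.sub_self,
      SimpleGraph.Walk.getVert_zero] at this
  obtain ⟨q, hq, hpq⟩ := (h _ _ _ A B C hA hB hC).1 _ hpA
  have close : ∀ a, edist q (vertex G a) ≤ 1 →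
      G.Reachable p a ∧ G.dist p a ≤ ⌈δ⌉₊ + 1 := by
    intro a ha
    have h1 : ((G.edist p a : ℕ∞) : ℝ≥0∞) ≤ ((⌈δ⌉₊ + 1 : ℕ) : ℕ∞) := by
      rw [← edist_vertex]
      refine (edist_triangle _ q _).trans ((add_le_add hpq ha).trans ?_)
      push_cast
      gcongr
      exact_mod_cast Nat.le_ceil δ
    have h2 := ENat.toENNReal_le.1 h1
    have hr := SimpleGraph.reachable_of_edist_ne_top
      (ne_top_of_le_ne_top (ENat.natCast_ne_top _) h2)
    rw [← hr.coe_dist_eq_edist] at h2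
    exact ⟨hr, by exact_mod_cast h2⟩
  rcases hq with hq | hq
  · right
    obtain ⟨i, hi, hqi⟩ := hB' q hq
    obtain ⟨hr, hd⟩ := close _ hqi
    have hg := isGeodesicSeq_getVert R hR
    have g1 := (hg 0 i i.zero_le hi).2
    have g2 := (hg i _ hi le_rfl).2
    rw [R.getVert_zero] at g1
    rw [R.getVert_length] at g2
    have t1 := hr.symm.dist_triangle_right y
    have t2 := hr.dist_triangle_left z
    rw [SimpleGraph.dist_comm (u := R.getVert i) (v := p)] at t1
    omega
  · left
    obtain ⟨i, hi, hqi⟩ := hC' q hq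
    obtain ⟨hr, hd⟩ := close _ hqi
    have hg := isGeodesicSeq_getVert T hT
    have g1 := (hg 0 i i.zero_le hi).2
    have g2 := (hg i _ hi le_rfl).2
    rw [T.getVert_zero] at g1
    rw [T.getVert_length] at g2
    have t1 := hr.symm.dist_triangle_right z
    have t2 := hr.dist_triangle_left x
    have e : ∀ a b, G.dist a b = G.dist b a := fun a b => SimpleGraph.dist_comm
    rw [e z p, e _ p] at t1
    rw [e p x] at t2
    rw [e z x] at hT
    omega

/-- An almost-centre of the vertices `x`, `y`, `z`: along a geodesic from `x` to `y`, it is the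
vertex just before the first one that is almost between `y` and `z`. -/
theorem ThinIntervals.exists_center {D : ℕ} (h : ThinIntervals G D) {x y z : V}
    (hxy : G.Reachable x y) (hxz : G.Reachable x z) :
    ∃ p, G.Reachable x p ∧ G.dist x p + G.dist p y = G.dist x y ∧
      G.dist x p + G.dist p z ≤ G.dist x z + D ∧
      G.dist y p + G.dist p z ≤ G.dist y z + (D + 2) := by
  classical
  obtain ⟨f, f0, f1, hf⟩ := exists_isGeodesicSeq hxy
  have hex : ∃ i, G.dist y (f i) + G.dist (f i) z ≤ G.dist y z + D :=
    ⟨G.dist x y, by simp [f1]⟩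
  have hle : Nat.find hex ≤ G.dist x y := Nat.find_min' hex (by simp [f1])
  have hspec := Nat.find_spec hex
  rcases hi : Nat.find hex with _ | k
  · rw [hi, f0] at hspec
    exact ⟨x, .rfl, by simp, by simp, by omega⟩
  · have hlast := Nat.find_min hex (m := k) (by omega)
    rw [hi] at hspec hle
    have h1 := hf 0 k (by omega) (by omega)
    have h2 := hf k _ (by omega) le_rfl
    have h3 := hf k (k + 1) (by omega) hle
    rw [f0] at h1
    rw [f1] at h2
    have t1 := h3.1.symm.reachable.dist_triangle_right y
    have t2 := h3.1.reachable.dist_triangle_left z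
    rw [SimpleGraph.dist_comm (u := f (k + 1)) (v := f k)] at t1
    have hsum : G.dist x (f k) + G.dist (f k) y = G.dist x y := by omega
    refine ⟨f k, h1.1.reachable, hsum, ?_, by omega⟩
    exact (h x y z (f k) hxz h1.1.reachable h2.1.reachable hsum).resolve_right hlast

/-- The centre `p` of `x`, `y`, `z` is almost between `x` and `w` or almost between `y` and `w`; in
the first case, the distances of `x` to `w` and of `y` to `z` are both almost attained through
`p`. -/
theorem ThinIntervals.fourPoint {D : ℕ} (h : ThinIntervals G D) : FourPoint G (2 * D + 2) := by
  intro x y z w hxy hxz hxw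
  obtain ⟨p, hxp, h1, h2, h3⟩ := h.exists_center hxy hxz
  have t := (hxz.symm.trans hxp).dist_triangle_left w
  have e : ∀ a b, G.dist a b = G.dist b a := fun a b => SimpleGraph.dist_comm
  rw [e z p] at t
  rw [e p y] at h1
  rcases h x y w p hxw hxp (hxp.symm.trans hxy) (by rw [e p y]; exact h1) with h4 | h4 <;> omega

theorem IsHyperbolic.exists_fourPoint (h : IsHyperbolic G) : ∃ C, FourPoint G C :=
  let ⟨_, hδ⟩ := h
  ⟨_, hδ.thinIntervals.fourPoint⟩

end ThinToFourPoint

/-! ### The four-point condition implies thin triangles -/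

section FourPointToThin

section Metric

variable {X : Type*} [MetricSpace X] {x y z : X} {S : Set X}

theorem IsGeodesicSegment.dist_add_dist (h : IsGeodesicSegment S x y) {p : X} (hp : p ∈ S) :
    dist x p + dist p y = dist x y := by
  obtain ⟨L, γ, hL, rfl, rfl, hγ, rfl⟩ := h
  obtain ⟨t, ht, rfl⟩ := hp
  have hd : ∀ s ∈ Set.Icc 0 L, ∀ t ∈ Set.Icc 0 L, dist (γ s) (γ t) = |s - t| := fun s hs t ht => by
    rw [dist_edist, hγ s hs t ht, ENNReal.toReal_ofReal (abs_nonneg _)]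
  rw [hd 0 ⟨le_rfl, hL⟩ t ht, hd t ht L ⟨hL, le_rfl⟩, hd 0 ⟨le_rfl, hL⟩ L ⟨hL, le_rfl⟩,
    zero_sub, zero_sub, abs_neg, abs_neg, abs_of_nonneg ht.1, abs_of_nonneg hL,
    abs_of_nonpos (by linarith [ht.2])]
  ring

theorem IsGeodesicSegment.exists_dist_eq (h : IsGeodesicSegment S x y) {r : ℝ} (h0 : 0 ≤ r)
    (h1 : r ≤ dist x y) : ∃ q ∈ S, dist x q = r ∧ dist y q = dist x y - r := by
  obtain ⟨L, γ, hL, rfl, rfl, hγ, rfl⟩ := h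
  have hd : ∀ s ∈ Set.Icc 0 L, ∀ t ∈ Set.Icc 0 L, dist (γ s) (γ t) = |s - t| := fun s hs t ht => by
    rw [dist_edist, hγ s hs t ht, ENNReal.toReal_ofReal (abs_nonneg _)]
  have hxy : dist (γ 0) (γ L) = L := by
    rw [hd 0 ⟨le_rfl, hL⟩ L ⟨hL, le_rfl⟩, zero_sub, abs_neg, abs_of_nonneg hL]
  rw [hxy] at h1 ⊢
  refine ⟨γ r, ⟨r, ⟨h0, h1⟩, rfl⟩, ?_, ?_⟩
  · rw [hd 0 ⟨le_rfl, hL⟩ r ⟨h0, h1⟩, zero_sub, abs_neg, abs_of_nonneg h0]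
  · rw [hd L ⟨hL, le_rfl⟩ r ⟨h0, h1⟩, abs_of_nonneg (by linarith)]

/-- A point that is almost between `x` and `z` is close to the point of a geodesic `[xz]` at the
same distance from `x`. -/
theorem exists_close_of_almost_between {C : ℝ} (hC : 0 ≤ C)
    (h4 : ∀ x y z w : X, dist x y + dist z w ≤
      max (dist x z + dist y w) (dist y z + dist x w) + C)
    (hS : ∀ r, 0 ≤ r → r ≤ dist x z → ∃ q ∈ S, dist x q = r ∧ dist z q = dist x z - r) {p : X}
    (hp : dist x p + dist p z ≤ dist x z + C) : ∃ q ∈ S, dist p q ≤ 2 * C := by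
  rcases le_total (dist x p) (dist x z) with h | h
  · obtain ⟨q, hq, h1, h2⟩ := hS _ dist_nonneg h
    refine ⟨q, hq, ?_⟩
    have key := h4 x z p q
    rw [h1, h2, dist_comm z p] at key
    rcases max_cases (dist x p + (dist x z - dist x p)) (dist p z + dist x p) with ⟨e, -⟩ | ⟨e, -⟩
    all_goals rw [e] at key; linarith
  · obtain ⟨q, hq, h1, h2⟩ := hS _ dist_nonneg le_rfl
    refine ⟨q, hq, ?_⟩
    have : dist p q ≤ dist p z + dist z q := dist_triangle _ _ _
    linarith

theorem isHyperbolicWith_of_fourPoint {C : ℝ≥0}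
    (h4 : ∀ x y z w : X, dist x y + dist z w ≤
      max (dist x z + dist y w) (dist y z + dist x w) + C) : IsHyperbolicWith X (2 * C) := by
  have key : ∀ (x y z : X) (A B D : Set X), IsGeodesicSegment A x y → IsGeodesicSegment B y z →
      IsGeodesicSegment D z x → InNeighborhood (2 * C) A (B ∪ D) := by
    intro x y z A B D hA hB hD p hp
    suffices h : ∃ q ∈ B ∪ D, dist p q ≤ 2 * C by
      obtain ⟨q, hq, hpq⟩ := h
      refine ⟨q, hq, ?_⟩
      rw [edist_nndist]
      exact_mod_cast hpq
    have hsum := hA.dist_add_dist hp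
    have h := h4 x y z p
    rw [dist_comm z p, dist_comm y p] at h
    rcases max_cases (dist x z + dist p y) (dist y z + dist x p) with ⟨e, -⟩ | ⟨e, -⟩
    · rw [e] at h
      obtain ⟨q, hq, hpq⟩ := exists_close_of_almost_between (x := x) (z := z) (S := D) C.2 h4
        (fun r h0 h1 => by
          obtain ⟨q, hq, e1, e2⟩ := hD.exists_dist_eq (r := dist x z - r) (by linarith)
            (by rw [dist_comm z x]; linarith)
          exact ⟨q, hq, by rw [e2, dist_comm z x]; ring, e1⟩)
        (p := p) (by change _ ≤ _ + (C : ℝ); linarith)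
      exact ⟨q, .inr hq, hpq⟩
    · rw [e] at h
      obtain ⟨q, hq, hpq⟩ := exists_close_of_almost_between (x := y) (z := z) (S := B) C.2 h4
        (fun r h0 h1 => hB.exists_dist_eq h0 h1)
        (p := p) (by change _ ≤ _ + (C : ℝ); rw [dist_comm y p]; linarith)
      exact ⟨q, .inl hq, hpq⟩
  exact fun x y z A B D hA hB hD =>
    ⟨key x y z A B D hA hB hD, key y z x B D A hB hD hA, key z x y D A B hD hA hB⟩

end Metric

open Realization

variable {V : Type*} {G : SimpleGraph V}

theorem exists_edist_vertex_le_one (x : Realization G) : ∃ a, edist x (vertex G a) ≤ 1 := by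
  obtain ⟨a, ha⟩ := x.exists_coord_ne
  have hv : (vertex G a).coord a = 1 := by simp [vertex, coord]
  refine ⟨a, (edist_le_via x (vertex G a) ha (b := a) (by simp [hv])).trans ?_⟩
  simp [hv, coord_nonneg]

theorem edist_vertex_of_connected (hG : G.Connected) (a b : V) :
    edist (vertex G a) (vertex G b) = (G.dist a b : ℝ≥0∞) := by
  rw [edist_vertex, ← (hG a b).coe_dist_eq_edist, ENat.toENNReal_coe]

theorem edist_ne_top_of_connected (hG : G.Connected) (x y : Realization G) : edist x y ≠ ⊤ := by
  obtain ⟨a, ha⟩ := exists_edist_vertex_le_one x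
  obtain ⟨b, hb⟩ := exists_edist_vertex_le_one y
  rw [edist_comm] at hb
  refine ne_top_of_le_ne_top ?_ ((edist_triangle4 x (vertex G a) (vertex G b) y).trans
    (add_le_add (add_le_add ha le_rfl) hb))
  rw [edist_vertex_of_connected hG]
  finiteness

theorem FourPoint.isHyperbolic (hG : G.Connected) {C : ℕ} (h : FourPoint G C) :
    IsHyperbolic G := by
  let _ : MetricSpace (Realization G) := EMetricSpace.toMetricSpace (edist_ne_top_of_connected hG)
  have hv : ∀ a b, dist (vertex G a) (vertex G b) = G.dist a b := by
    intro a b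
    rw [dist_edist]
    exact (congrArg ENNReal.toReal (edist_vertex_of_connected hG a b)).trans (by simp)
  have near : ∀ x : Realization G, ∃ a, dist x (vertex G a) ≤ 1 := by
    intro x
    obtain ⟨a, ha⟩ := exists_edist_vertex_le_one x
    exact ⟨a, ENNReal.toReal_le_of_le_ofReal zero_le_one (by simpa using ha)⟩
  choose v hnear using near
  have h1 : ∀ x y, dist x y ≤ G.dist (v x) (v y) + 2 := by
    intro x y
    have := dist_triangle4 x (vertex G (v x)) (vertex G (v y)) y
    rw [hv, dist_comm (vertex G (v y)) y] at this
    linarith [hnear x, hnear y]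
  have h2 : ∀ x y, (G.dist (v x) (v y) : ℝ) ≤ dist x y + 2 := by
    intro x y
    have := dist_triangle4 (vertex G (v x)) x y (vertex G (v y))
    rw [hv, dist_comm (vertex G (v x)) x] at this
    linarith [hnear x, hnear y]
  refine ⟨2 * (C + 8), isHyperbolicWith_of_fourPoint (X := Realization G) fun x y z w => ?_⟩
  have key : (G.dist (v x) (v y) : ℝ) + G.dist (v z) (v w) ≤
      max ((G.dist (v x) (v z) : ℝ) + G.dist (v y) (v w))
        (G.dist (v y) (v z) + G.dist (v x) (v w)) + C := by
    exact_mod_cast h (v x) (v y) (v z) (v w) (hG _ _) (hG _ _) (hG _ _)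
  have hmax : max ((G.dist (v x) (v z) : ℝ) + G.dist (v y) (v w))
      (G.dist (v y) (v z) + G.dist (v x) (v w)) ≤
        max (dist x z + dist y w) (dist y z + dist x w) + 4 := by
    rw [← max_add_add_right]
    exact max_le_max (by linarith [h2 x z, h2 y w]) (by linarith [h2 y z, h2 x w])
  push_cast
  linarith [h1 x y, h1 z w]

theorem isBounded_of_dist_le (hG : G.Connected) {N : ℕ} (h : ∀ a b, G.dist a b ≤ N) :
    IsBounded G := by
  refine lt_of_le_of_lt (b := 1 + (N : ℝ≥0∞) + 1) (Metric.ediam_le fun x _ y _ => ?_) (by finiteness)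
  obtain ⟨a, ha⟩ := exists_edist_vertex_le_one x
  obtain ⟨b, hb⟩ := exists_edist_vertex_le_one y
  rw [edist_comm] at hb
  refine (edist_triangle4 x (vertex G a) (vertex G b) y).trans
    (add_le_add (add_le_add ha ?_) hb)
  rw [edist_vertex_of_connected hG]
  exact_mod_cast h a b

end FourPointToThin

end GraphHyp

theorem theorem2 {V : Type*} {W : Type*} [Nontrivial V] [Nontrivial W]
    (G₁ : SimpleGraph V) (G₂ : SimpleGraph W) (hG₁ : G₁.Connected) (hG₂ : G₂.Connected)
    (h : GraphHyp.IsHyperbolic (GraphHyp.directProduct G₁ G₂)) :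
    (GraphHyp.IsHyperbolic G₁ ∧ GraphHyp.IsBounded G₂) ∨
      (GraphHyp.IsHyperbolic G₂ ∧ GraphHyp.IsBounded G₁) := by
  obtain ⟨C, hC⟩ := h.exists_fourPoint
  obtain ⟨C₁, hC₁⟩ := hC.left hG₁ hG₂
  obtain ⟨C₂, hC₂⟩ := hC.directProduct_swap.left hG₂ hG₁
  rcases hC.bounded_or_bounded hG₁ hG₂ with ⟨N, hN⟩ | ⟨N, hN⟩
  · exact .inr ⟨hC₂.isHyperbolic hG₂, GraphHyp.isBounded_of_dist_le hG₁ hN⟩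
  · exact .inl ⟨hC₁.isHyperbolic hG₁, GraphHyp.isBounded_of_dist_le hG₂ hN⟩
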